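/- A \emph{hyperbolic polyhedron} is a compact intersection of finitely many half-spaces of $\mathbb{H}^3$ with non-empty interior; it has \emph{$1$-skeleton} $\Gamma$ if the graph formed by its vertices and edges has been identified (by a graph isomorphism) with the finite graph $\Gamma$. Then $\Gamma$ is planar and $3$-connected, and so embeds in $S^2\subset S^3$ in an essentially unique way. For an odd integer $r>2$, an \emph{$r$-admissible coloring} of $\Gamma$ assigns to each edge an even number in $\{0,2,\dots,r-3\}$ such that the colors $a,b,c$ at each trivalent vertex satisfy the triangle inequalities and $a+b+c\le 2(r-2)$, and such that, at a vertex of higher valence, the colors extend to a coloring with these properties of a trivalent tree replacing the vertex. For a primitive $r$-th root of unity $q$ let $$Y_r(S^3,\Gamma,col,q)=\sum_{col'}\Bigl(\prod_{e}\Delta_{col'(e)}\Bigr)\Bigl(\prod_{v}\theta_v\Bigr)^{-1}\langle\Gamma',col\cup col'\rangle^2$$ be the Yokota invariant. Here $\Gamma'$ is a planar trivalent graph obtained by replacing every vertex of $\Gamma$ by a planar trivalent tree, $col'$ runs over the colorings of the new edges $e$ for which $col\cup col'$ is $r$-admissible, $\langle\cdot\rangle$ is the Kauffman bracket (edges cabled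 by Jones--Wenzl projectors, a loop having the value $-q-q^{-1}$), $\Delta_n$ is the bracket of the unknot colored with $n$, and $\theta_v$ is the bracket of the theta graph with the three colors at the vertex $v$ of $\Gamma'$. \textbf{Volume Conjecture for polyhedra.} Let $P$ be a hyperbolic polyhedron with $1$-skeleton $\Gamma$ and dihedral angles $\alpha_e$ at the edges $e$ of $\Gamma$, and let $col_r$ ($r>2$ odd) be a sequence of $r$-admissible colorings of $\Gamma$ such that $2\pi\lim_{r\to\infty} col_r(e)/r=\pi-\alpha_e$ for every edge $e$. Then $$\lim_{r\to\infty}\frac{\pi}{r}\log\bigl|Y_r(S^3,\Gamma,col_r,e^{2\pi i/r})\bigr|=\mathrm{Vol}(P).$$ \textbf{Weak Stoker Conjecture.} If $P_1$ and $P_2$ are two hyperbolic polyhedra with the same $1$-skeleton $\Gamma$ and, for every edge of $\Gamma$, the same dihedral angle at the corresponding edges, then $\mathrm{Vol}(P_1)=\mathrm{Vol}(P_2)$. \textbf{Proposition.} If the Volume Conjecture for polyhedra is true, then the weak Stoker Conjecture is true. Moreover, in that case, for any $P_1,P_2$ as in the weak Stoker Conjecture, with common dihedral angles $\theta_e$,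 there is a sequence $col_r$ ($r>2$ odd) of $r$-admissible colorings of $\Gamma$ with $2\pi\lim_{r\to\infty} col_r(e)/r=\pi-\theta_e$ for every edge $e$ and $$\lim_{r\to\infty}\frac{\pi}{r}\log\bigl|Y_r(S^3,\Gamma,col_r,e^{2\pi i/r})\bigr|=\mathrm{Vol}(P_1)=\mathrm{Vol}(P_2).$$ -/

import Mathlib

open Filter Topology

universe u

noncomputable section

namespace StokerYokota

/-! ### Hyperbolic polyhedra in the projective (Klein) model

Hyperbolic space `ℍ³` is the open unit ball of `ℝ³`; the point `x` stands for the timelike line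
through `(x, 1)` in Minkowski space, so that hyperbolic half-spaces are the intersections of the
ball with Euclidean half-spaces and geodesic segments are Euclidean segments. -/

abbrev E3 : Type := EuclideanSpace ℝ (Fin 3)

/-- The Klein model of hyperbolic 3-space. -/
def ball3 : Set E3 := Metric.ball 0 1

/-- A half-space `{x ∈ ℍ³ : ⟪u, x⟫ ≤ c}`; the condition `|c| < ‖u‖` says that its outward Minkowski
normal `(u, c)` is spacelike, i.e. that the bounding plane meets `ℍ³`. -/
structure HalfSpace where
  normal : E3
  offset : ℝ
  meets : |offset| < ‖normal‖

def HalfSpace.carrier (h : HalfSpace) : Set E3 :=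
  {x | x ∈ ball3 ∧ inner ℝ h.normal x ≤ h.offset}

/-- The bounding hyperbolic plane of a half-space. -/
def HalfSpace.wall (h : HalfSpace) : Set E3 :=
  {x | x ∈ ball3 ∧ inner ℝ h.normal x = h.offset}

/-- Minkowski product of the outward normals of two half-spaces. -/
def HalfSpace.lorentz (h k : HalfSpace) : ℝ :=
  inner ℝ h.normal k.normal - h.offset * k.offset

/-- The angle between the outward normals of two half-spaces (with crossing walls). -/
def HalfSpace.exteriorAngle (h k : HalfSpace) : ℝ :=
  Real.arccos (h.lorentz k / (Real.sqrt (h.lorentz h) * Real.sqrt (k.lorentz k)))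

/-- A hyperbolic polyhedron: a compact intersection of finitely many half-spaces of `ℍ³`
with non-empty interior. -/
structure HypPolyhedron where
  carrier : Set E3
  exists_halfSpaces : ∃ S : Finset HalfSpace,
    carrier = {x | x ∈ ball3 ∧ ∀ h ∈ S, x ∈ h.carrier}
  isCompact : IsCompact carrier
  interior_nonempty : (interior carrier).Nonempty

namespace HypPolyhedron

variable (P : HypPolyhedron)

/-- Hyperbolic volume: the Riemannian volume form of the Klein model is `(1 - ‖x‖²)⁻² dx`. -/
def vol : ℝ := ∫ x in P.carrier, ((1 - ‖x‖ ^ 2) ^ 2)⁻¹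

/-- The vertices of the polyhedron. -/
abbrev Vertex : Type := {v : E3 // v ∈ P.carrier.extremePoints ℝ}

/-- The 1-skeleton: two distinct vertices are adjacent if the segment between them is a face
of the polyhedron, i.e. an edge. -/
def skeleton : SimpleGraph P.Vertex where
  Adj v w := v ≠ w ∧ IsExtreme ℝ P.carrier (segment ℝ v.1 w.1)
  symm := ⟨fun v w h => ⟨h.1.symm, by rw [segment_symm]; exact h.2⟩⟩
  loopless := ⟨fun _ h => h.1 rfl⟩

/-- The half-space `h` supports a (2-dimensional) face of the polyhedron. -/
def SupportsFacet (h : HalfSpace) : Prop :=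
  P.carrier ⊆ h.carrier ∧
    Module.finrank ℝ (vectorSpan ℝ (P.carrier ∩ h.wall)) = 2

/-- The (interior) dihedral angle along the edge `vw` is `θ`: two different facets contain `v` and
`w`, and `θ` is `π` minus the angle between their outward normals. -/
def HasDihedralAngle (v w : E3) (θ : ℝ) : Prop :=
  ∃ h k : HalfSpace, P.SupportsFacet h ∧ P.SupportsFacet k ∧
    P.carrier ∩ h.wall ≠ P.carrier ∩ k.wall ∧
    v ∈ h.wall ∧ w ∈ h.wall ∧ v ∈ k.wall ∧ w ∈ k.wall ∧
    θ = Real.pi - h.exteriorAngle k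

/-- The polyhedron, with its 1-skeleton identified with `Γ` through `φ`, has the dihedral angle
`θ e` at the edge corresponding to `e`, for every edge `e` of `Γ`. -/
def HasAngles {V : Type*} {Γ : SimpleGraph V} (φ : Γ ≃g P.skeleton) (θ : Γ.edgeSet → ℝ) : Prop :=
  ∀ (v w : V) (hvw : Γ.Adj v w),
    P.HasDihedralAngle (φ v).1 (φ w).1 (θ ⟨s(v, w), hvw⟩)

end HypPolyhedron

/-! ### Temperley-Lieb diagrams and Jones-Wenzl projectors -/

/-- The quantum integer `[n] = (q ^ n - q ^ (-n)) / (q - q ^ (-1))`. -/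
def quantumInt (q : ℂ) (n : ℕ) : ℂ := (q ^ n - q⁻¹ ^ n) / (q - q⁻¹)

/-- The value `Δ_n = (-1) ^ n [n + 1]` of the unknot coloured with `n`. -/
def unknotValue (q : ℂ) (n : ℕ) : ℂ := (-1) ^ n * quantumInt q (n + 1)

/-- A diagram on `n` strands, given by the partition of the `n` upper end points (`Sum.inl`, numbered
from left to right) and the `n` lower end points (`Sum.inr`) that records which of them are joined.
Only partitions coming from planar pairings occur below. -/
abbrev Diagram (n : ℕ) : Type := Setoid (Fin n ⊕ Fin n)

/-- The partition of the upper, middle and lower points after stacking `s` upon `t`. -/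
def Diagram.glue {n : ℕ} (s t : Diagram n) : Setoid (Fin n ⊕ (Fin n ⊕ Fin n)) :=
  Relation.EqvGen.setoid fun x y =>
    (∃ a b, s a b ∧ x = Sum.map id Sum.inl a ∧ y = Sum.map id Sum.inl b) ∨
    (∃ a b, t a b ∧ x = Sum.inr a ∧ y = Sum.inr b)

/-- The diagram obtained by stacking `s` upon `t` and deleting closed loops. -/
@[reducible] def Diagram.comp {n : ℕ} (s t : Diagram n) : Diagram n :=
  (s.glue t).comap (Sum.map id Sum.inr)

/-- The number of closed loops that appear when `s` is stacked upon `t`. -/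
def Diagram.loops {n : ℕ} (s t : Diagram n) : ℕ :=
  Nat.card {c : Quotient (s.glue t) //
    ∀ x, Quotient.mk (s.glue t) x = c → ∃ i, x = Sum.inr (Sum.inl i)}

/-- Product of linear combinations of diagrams; a closed loop has the value
`Δ_1 = -q - q ^ (-1)`. -/
def tlMul (q : ℂ) {n : ℕ} (f g : Diagram n →₀ ℂ) : Diagram n →₀ ℂ :=
  f.sum fun s a => g.sum fun t b =>
    Finsupp.single (s.comp t) (a * b * unknotValue q 1 ^ s.loops t)

/-- Add a vertical strand on the right. -/
@[reducible] def Diagram.addStrand {n : ℕ} (s : Diagram n) : Diagram (n + 1) :=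
  Relation.EqvGen.setoid fun x y =>
    (∃ a b, s a b ∧ x = Sum.map Fin.castSucc Fin.castSucc a ∧
      y = Sum.map Fin.castSucc Fin.castSucc b) ∨
    (x = Sum.inl (Fin.last n) ∧ y = Sum.inr (Fin.last n))

/-- The identity diagram. -/
@[reducible] def Diagram.identity (n : ℕ) : Diagram n :=
  Relation.EqvGen.setoid fun x y => ∃ i, x = Sum.inl i ∧ y = Sum.inr i

/-- The hook generator on the two rightmost strands: the identity on the other strands, a cap and
a cup on the last two. -/
@[reducible] def Diagram.hook (n : ℕ) : Diagram (n + 2) :=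
  Relation.EqvGen.setoid fun x y =>
    (∃ i : Fin n, x = Sum.inl i.castSucc.castSucc ∧ y = Sum.inr i.castSucc.castSucc) ∨
    (x = Sum.inl (Fin.last n).castSucc ∧ y = Sum.inl (Fin.last (n + 1))) ∨
    (x = Sum.inr (Fin.last n).castSucc ∧ y = Sum.inr (Fin.last (n + 1)))

/-- The Jones-Wenzl projector, through Wenzl's recursion
`f_{n+2} = f_{n+1} ⊗ 1 - (Δ_n / Δ_{n+1}) (f_{n+1} ⊗ 1) e_{n+1} (f_{n+1} ⊗ 1)`. -/
def jonesWenzl (q : ℂ) : (n : ℕ) → (Diagram n →₀ ℂ)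
  | 0 => Finsupp.single (Diagram.identity 0) 1
  | 1 => Finsupp.single (Diagram.identity 1) 1
  | n + 2 =>
    let g : Diagram (n + 2) →₀ ℂ := (jonesWenzl q (n + 1)).mapDomain Diagram.addStrand
    g - (unknotValue q n / unknotValue q (n + 1)) •
      tlMul q (tlMul q g (Finsupp.single (Diagram.hook n) 1)) g

/-! ### The Kauffman bracket of a coloured planar trivalent graph -/

/-- A trivalent graph on an oriented surface as a combinatorial map on its set `T` of half-edges:
`rot` turns counterclockwise around the vertex, `opp` exchanges the halves of an edge. -/
structure TrivalentMap (T : Type*) where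
  rot : Equiv.Perm T
  opp : Equiv.Perm T
  rot_ne : ∀ t, rot t ≠ t
  rot_cube : ∀ t, rot (rot (rot t)) = t
  opp_ne : ∀ t, opp t ≠ t
  opp_opp : ∀ t, opp (opp t) = t

namespace TrivalentMap

variable {T : Type*} (M : TrivalentMap T) (col : T → ℕ)

/-- Strand end points. A half-edge `t` of colour `n = col t` carries `n` strands, numbered
counterclockwise as seen from its vertex; each has an end (`Sum.inl`) at the vertex and an end
(`Sum.inr`) at the middle of the edge. -/
abbrev StrandEnd : Type _ := (t : T) × (Fin (col t) ⊕ Fin (col t))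

/-- The partition of the strand ends into closed curves when the diagram `D t` is inserted in each
half-edge `t`. At a vertex with colours `a, b, c` in counterclockwise order, the last
`(a + b - c) / 2` strands of the first half-edge are joined, without crossings, to the first ones of
the second half-edge. In the middle of an edge the strands of its two halves are joined; the two
numberings are opposite to each other. -/
def curves (D : (t : T) → Diagram (col t)) : Setoid (StrandEnd col) :=
  Relation.EqvGen.setoid fun x y =>
    (∃ t a b, D t a b ∧ x = ⟨t, a⟩ ∧ y = ⟨t, b⟩) ∨
    (∃ (t : T) (i : Fin (col t)) (j : Fin (col (M.rot t))),
      x = ⟨t, Sum.inl i⟩ ∧ y = ⟨M.rot t, Sum.inl j⟩ ∧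
      i.val + j.val + 1 = col t ∧
      2 * j.val + col (M.rot (M.rot t)) < col t + col (M.rot t)) ∨
    (∃ (t : T) (i : Fin (col t)) (j : Fin (col (M.opp t))),
      x = ⟨t, Sum.inr i⟩ ∧ y = ⟨M.opp t, Sum.inr j⟩ ∧ i.val + j.val + 1 = col t)

open scoped Classical in
/-- The Kauffman bracket of the planar trivalent graph `M` with (admissible) colours `col`: edges
are cabled by Jones-Wenzl projectors and every closed curve is replaced by `-q - q ^ (-1)`.
Each of the two halves of an edge carries a projector; since projectors are idempotent
this is the same as one projector per edge. -/
def bracket [Fintype T] (q : ℂ) : ℂ :=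
  ∑ D ∈ Fintype.piFinset fun t => (jonesWenzl q (col t)).support,
    (∏ t, jonesWenzl q (col t) (D t)) * unknotValue q 1 ^ Nat.card (Quotient (M.curves col D))

end TrivalentMap

/-- The planar theta graph. -/
def thetaMap : TrivalentMap (Bool × Fin 3) where
  rot := (Equiv.refl Bool).prodCongr (Equiv.addRight 1)
  opp := Equiv.boolNot.prodCongr (Equiv.neg (Fin 3))
  rot_ne := by decide
  rot_cube := by decide
  opp_ne := by decide
  opp_opp := by decide

/-- The Kauffman bracket of the planar theta graph with edges coloured `a, b, c`. -/
def theta (q : ℂ) (a b c : ℕ) : ℂ :=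
  thetaMap.bracket (fun t => ![a, b, c] (if t.1 then -t.2 else t.2)) q

/-! ### Admissible colourings -/

/-- `r`-admissible triples of colours (the colours are even numbers less than `r - 2`). -/
def AdmissibleTriple (r a b c : ℕ) : Prop :=
  (Even a ∧ a + 2 < r) ∧ (Even b ∧ b + 2 < r) ∧ (Even c ∧ c + 2 < r) ∧
    a ≤ b + c ∧ b ≤ c + a ∧ c ≤ a + b ∧ a + b + c + 4 ≤ 2 * r

/-- The colours in the list can be the colours of the leaves of a trivalent tree with
`r`-admissible colours, whose remaining end has the colour `c`. -/
def FusesTo (r : ℕ) : List ℕ → ℕ → Prop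
  | [], c => c = 0
  | a :: l, c => ∃ c', FusesTo r l c' ∧ AdmissibleTriple r c' a c

/-- `r`-admissible colourings of the edges of a graph: the colours are even numbers less than
`r - 2`, and the colours of the edges at each vertex extend to an `r`-admissible
colouring of a trivalent tree that replaces the vertex. For a trivalent vertex this says that the
three colours form an `r`-admissible triple. -/
def IsAdmissible {V : Type*} (Γ : SimpleGraph V) (r : ℕ) (col : Γ.edgeSet → ℕ) : Prop :=
  (∀ e, Even (col e) ∧ col e + 2 < r) ∧
    ∀ v : V, ∃ l : List Γ.edgeSet, l.Nodup ∧ (∀ e : Γ.edgeSet, e ∈ l ↔ v ∈ e.1) ∧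
      FusesTo r (l.map col) 0

/-! ### The Yokota invariant of a planar graph -/

/-- The involution of the darts (oriented edges) of a graph that reverses them. -/
def flipDart {V : Type*} (Γ : SimpleGraph V) : Equiv.Perm Γ.Dart :=
  Function.Involutive.toPerm SimpleGraph.Dart.symm SimpleGraph.Dart.symm_involutive

/-- An embedding of a connected graph in the oriented sphere, given up to isotopy by the
counterclockwise cyclic order `rot` of the darts issuing from each vertex; Euler's formula says that
the surface is a sphere. One dart `last v` at each vertex is marked. -/
structure PlanarEmbedding {V : Type*} (Γ : SimpleGraph V) where
  rot : Equiv.Perm Γ.Dart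
  fst_rot : ∀ d, (rot d).fst = d.fst
  sameCycle : ∀ d d' : Γ.Dart, d.fst = d'.fst → rot.SameCycle d d'
  connected : Γ.Connected
  euler : Nat.card V + Nat.card (Quotient (Equiv.Perm.SameCycle.setoid (rot * flipDart Γ))) =
    Nat.card Γ.edgeSet + 2
  last : V → Γ.Dart
  fst_last : ∀ v, (last v).fst = v

namespace PlanarEmbedding

variable {V : Type*} {Γ : SimpleGraph V} (E : PlanarEmbedding Γ)

/-- The map on `Γ.Dart × Fin 3` that exchanges the half-edges `(d, 1)` and `(rot d, 2)`, and
`(d, 0)` and `(d.symm, 0)`. -/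
def truncOpp (x : Γ.Dart × Fin 3) : Γ.Dart × Fin 3 :=
  if x.2 = 0 then (x.1.symm, 0) else if x.2 = 1 then (E.rot x.1, 2) else (E.rot⁻¹ x.1, 1)

theorem truncOpp_involutive : Function.Involutive E.truncOpp := by
  rintro ⟨d, i⟩
  fin_cases i <;> simp [truncOpp]

/-- The planar trivalent graph obtained by replacing every vertex of `Γ` by a small circle. It has a
trivalent vertex for each dart `d` of `Γ`, with half-edges, in counterclockwise order, `(d, 0)`
along `d`, `(d, 1)` along the circle to the vertex of `rot d`, and `(d, 2)` along the circle to the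
vertex of `rot⁻¹ d`. -/
def truncation : TrivalentMap (Γ.Dart × Fin 3) where
  rot := (Equiv.refl Γ.Dart).prodCongr (Equiv.addRight 1)
  opp := E.truncOpp_involutive.toPerm
  rot_ne := by
    rintro ⟨d, i⟩
    fin_cases i <;> simp
  rot_cube := by
    rintro ⟨d, i⟩
    fin_cases i <;> simp
  opp_ne := by
    rintro ⟨d, i⟩
    fin_cases i <;> simp [truncOpp, SimpleGraph.Dart.symm_ne]
  opp_opp := E.truncOpp_involutive

/-- The colouring of the truncation by `col` on the edges of `Γ` and by `c` on the
circles, `c d` being the colour of the arc between the vertices of `d` and `rot d`. -/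
def truncColor (col : Γ.edgeSet → ℕ) (c : Γ.Dart → ℕ) (x : Γ.Dart × Fin 3) : ℕ :=
  ![col ⟨x.1.edge, x.1.edge_mem⟩, c x.1, c (E.rot⁻¹ x.1)] x.2

open scoped Classical in
/-- The Yokota invariant: every vertex is replaced by a planar trivalent tree `τ`, and
`Y_r = ∑ (∏ Δ_{new edges}) (∏ θ_{vertices})⁻¹ ⟨Γ'⟩²`, where `Γ'` is the resulting
planar trivalent graph and the sum is over the admissible colours of the new edges (the square is
the product of the bracket of `Γ'` and of that of its mirror image, which agree as `Γ'` is planar).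
Here the tree `τ` at `v` is the circle of the truncation without the arc that follows
the dart `last v`: this arc gets the colour `0`, which means that it is erased.
The first and the last vertex on the remaining arc become bivalent with colours
`(a, a, 0)`; each contributes a factor `θ(a, a, 0)⁻¹ = Δ_a⁻¹`, cancelling the factor `Δ_a` of the
new edge of colour `a` at it. -/
def yokota [Fintype V] (r : ℕ) (col : Γ.edgeSet → ℕ) (q : ℂ) : ℂ :=
  ∑ c : Γ.Dart → Fin r with
      (∀ v, (c (E.last v)).val = 0) ∧
      ∀ d : Γ.Dart, AdmissibleTriple r (col ⟨d.edge, d.edge_mem⟩) (c d) (c (E.rot⁻¹ d)),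
    (∏ d : Γ.Dart, unknotValue q (c d)) *
      (∏ d : Γ.Dart, theta q (col ⟨d.edge, d.edge_mem⟩) (c d) (c (E.rot⁻¹ d)))⁻¹ *
      (E.truncation.bracket (E.truncColor col fun d => c d) q) ^ 2

end PlanarEmbedding

open scoped Classical in
/-- The Yokota invariant `Y_r(S³, Γ, col, q)` of a planar graph, embedded in `S²`. (It does not
depend on the marked darts; a 3-connected planar graph has only one embedding in `S²` up to
isotopy and reflection, and reflection does not change the invariant either. The value for graphs
without an embedding is never used: 1-skeleta of polyhedra are planar.) -/
def yokotaInvariant {V : Type*} [Fintype V] (Γ : SimpleGraph V) (r : ℕ) (col : Γ.edgeSet → ℕ)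
    (q : ℂ) : ℂ :=
  if h : Nonempty (PlanarEmbedding Γ) then h.some.yokota r col q else 0

/-! ### The conjectures -/

/-- `r → ∞` through odd integers. -/
def oddAtTop : Filter ℕ := atTop ⊓ 𝓟 {r | Odd r}

/-- `π / r * log |Y_r(S³, Γ, col_r, exp (2πi / r))|`. -/
def yokotaGrowth {V : Type*} [Fintype V] (Γ : SimpleGraph V) (col : ℕ → Γ.edgeSet → ℕ) (r : ℕ) : ℝ :=
  Real.pi / r *
    Real.log ‖yokotaInvariant Γ r (col r) (Complex.exp (2 * Real.pi * Complex.I / r))‖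

/-- `col` is a sequence of `r`-admissible colourings, `r > 2` odd, such that
`2 π lim col_r(e) / r = π - θ e` for all edges `e`. -/
def IsColoringSequence {V : Type*} (Γ : SimpleGraph V) (θ : Γ.edgeSet → ℝ)
    (col : ℕ → Γ.edgeSet → ℕ) : Prop :=
  (∀ r, Odd r → 2 < r → IsAdmissible Γ r (col r)) ∧
    ∀ e, Tendsto (fun r : ℕ => 2 * Real.pi * ((col r e : ℝ) / r)) oddAtTop (𝓝 (Real.pi - θ e))

/-- The Volume Conjecture for (compact hyperbolic) polyhedra. -/
def VolumeConjecture : Prop :=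
  ∀ (V : Type u) [Fintype V] (Γ : SimpleGraph V) (P : HypPolyhedron) (φ : Γ ≃g P.skeleton)
    (θ : Γ.edgeSet → ℝ), P.HasAngles φ θ →
    ∀ col : ℕ → Γ.edgeSet → ℕ, IsColoringSequence Γ θ col →
      Tendsto (yokotaGrowth Γ col) oddAtTop (𝓝 P.vol)

/-- The weak Stoker Conjecture. -/
def WeakStokerConjecture : Prop :=
  ∀ (V : Type u) [Fintype V] (Γ : SimpleGraph V) (P₁ P₂ : HypPolyhedron)
    (φ₁ : Γ ≃g P₁.skeleton) (φ₂ : Γ ≃g P₂.skeleton) (θ : Γ.edgeSet → ℝ),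
    P₁.HasAngles φ₁ θ → P₂.HasAngles φ₂ θ → P₁.vol = P₂.vol

end StokerYokota

end

noncomputable section

namespace StokerYokota

/-! The Volume Conjecture evaluates the growth along any admissible colouring sequence with the
right limits, and such a sequence mentions only `Γ` and `θ`. If one exists, both volumes are the
limit of the same function, hence equal. The content is therefore existence.

Rounding `r (π - θ e) / 2π` up to an even number gives the right limits. It is admissible at a
vertex because the exterior angles there satisfy the polygon inequality (`HasAngles.pi_sub_le_sum`):
each is at most the sum of the others. Geometrically, they are the side lengths of the polar polygon
of the spherical link: its corners are the facet normals at the vertex, and each edge joins the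
normals of its two facets. Since each facet through the vertex contains exactly two edges there
(`exists_two_edges`) and each edge lies on only two facets (`IsFacetNormal.eq_or_eq`), every corner
has even degree, and the triangle inequality on the sphere finishes
(`dist_le_sum_of_even_incidence`). Parity absorbs the rounding error, and a greedy fusion turns the
integer inequality into a coloured tree. -/

/-! ### Fusion of even colours at a vertex -/

/-- Greedy fusion: add the colours one at a time and cap the running total at `M`. Truncation keeps
the triangle inequalities because each new colour is itself at most `M`, and `3 * M + 4 ≤ 2 * r`
settles the perimeter bound. -/
theorem fusesTo_min_sum {r M : ℕ} (hM : Even M) (hMr : M + 2 < r) (h3 : 3 * M + 4 ≤ 2 * r)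
    (l : List ℕ) (hl : ∀ a ∈ l, Even a ∧ a ≤ M) : FusesTo r l (min M l.sum) := by
  induction l with
  | nil => simp [FusesTo]
  | cons a l ih =>
    have hmin : ∀ k : List ℕ, (∀ a ∈ k, Even a ∧ a ≤ M) → Even (min M k.sum) := by
      intro k hk
      have hs : Even k.sum := by
        induction k with
        | nil => simp
        | cons b k ihk =>
          rw [List.sum_cons]
          exact (hk b (by simp)).1.add (ihk fun x hx => hk x (by simp [hx]))
      rcases le_total M k.sum with h | h
      · rwa [min_eq_left h]
      · rwa [min_eq_right h]
    have hl' : ∀ b ∈ l, Even b ∧ b ≤ M := fun x hx => hl x (by simp [hx])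
    have ha := hl a (by simp)
    refine ⟨min M l.sum, ih hl', ⟨hmin l hl', ?_⟩, ⟨ha.1, ?_⟩, ⟨hmin _ hl, ?_⟩, ?_⟩ <;>
      (try simp only [List.sum_cons]) <;> omega

/-- With the largest colour `a` as the cap, the remaining colours fuse to exactly `a`, and the
triple `(a, a, 0)` closes the tree. -/
theorem fusesTo_zero_of_le_sum {r a : ℕ} (ha : Even a) (har : a + 2 < r) (h3 : 3 * a + 4 ≤ 2 * r)
    (l : List ℕ) (hl : ∀ b ∈ l, Even b ∧ b ≤ a) (hsum : a ≤ l.sum) : FusesTo r (a :: l) 0 := by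
  refine ⟨a, ?_, ⟨ha, har⟩, ⟨ha, har⟩, ⟨by simp, by omega⟩, ?_⟩
  · simpa [min_eq_left hsum] using fusesTo_min_sum ha har h3 l hl
  · omega

/-! ### Polygon inequality from parity of incidences -/

/-- If every point is an end of an even number of the segments `ab` and those of `L`, then the
length of `ab` is at most the total length of `L`. -/
theorem dist_le_sum_of_even_incidence {F : Type*} [DecidableEq F] (δ : F → F → ℝ) (hself : ∀ a, δ a a = 0)
    (hsymm : ∀ a b, δ a b = δ b a) (htri : ∀ a b c, δ a c ≤ δ a b + δ b c)
    (L : Multiset (F × F)) (a b : F)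
    (heven : ∀ f, Even ((if f = a then 1 else 0) + (if f = b then 1 else 0) +
      (L.map fun p => (if f = p.1 then 1 else 0) + (if f = p.2 then 1 else 0)).sum)) :
    δ a b ≤ (L.map fun p => δ p.1 p.2).sum := by
  induction hn : L.card generalizing L b with
  | zero =>
    obtain rfl := Multiset.card_eq_zero.1 hn
    have h := heven a
    by_cases hab : a = b
    · simp [hab, hself]
    · simp [hab] at h
  | succ n ih =>
    have hnonneg : ∀ x y, 0 ≤ δ x y := fun x y => by
      have := htri x y x
      rw [hself, hsymm y x] at this
      linarith
    by_cases hab : a = b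
    · rw [hab, hself]
      refine Multiset.sum_nonneg fun x hx => ?_
      obtain ⟨p, -, rfl⟩ := Multiset.mem_map.1 hx
      exact hnonneg _ _
    -- The segment `ab` contributes one incidence at `b`, so by parity some segment of `L` also ends
    -- there.
    obtain ⟨p, hp, hpb⟩ : ∃ p ∈ L, b = p.1 ∨ b = p.2 := by
      by_contra! hcon
      have h := heven b
      have h0 : (L.map fun p : F × F =>
          (if b = p.1 then 1 else 0) + (if b = p.2 then 1 else 0)).sum = 0 := by
        refine Multiset.sum_eq_zero fun x hx => ?_
        obtain ⟨p, hp, rfl⟩ := Multiset.mem_map.1 hx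
        simp [hcon p hp]
      rw [h0] at h
      simp [Ne.symm hab] at h
    obtain ⟨L, rfl⟩ := Multiset.exists_cons_of_mem hp
    have hcard : L.card = n := by simpa using hn
    -- Walk along that segment to its other end `c`: replacing `b` by `c` and removing the segment
    -- changes each incidence count by an even number.
    obtain ⟨c, hc, hδ⟩ : ∃ c, (∀ f, (if f = p.1 then 1 else 0) + (if f = p.2 then 1 else 0) =
        (if f = b then 1 else 0) + (if f = c then 1 else 0)) ∧ δ p.1 p.2 = δ c b := by
      rcases hpb with rfl | rfl
      · exact ⟨p.2, fun f => rfl, hsymm _ _⟩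
      · exact ⟨p.1, fun f => add_comm _ _, rfl⟩
    have := ih L c (fun f => by
      have h := heven f
      rw [Multiset.map_cons, Multiset.sum_cons, hc f] at h
      rw [Nat.even_iff] at h ⊢
      omega) hcard
    rw [Multiset.map_cons, Multiset.sum_cons, hδ]
    linarith [htri a c b]

/-! ### Faces and edges of compact convex sets -/

section Faces

variable {E : Type*} [NormedAddCommGroup E] [InnerProductSpace ℝ E]

/-- A combination of two nonpositive numbers with positive weights vanishes only if both do. -/
theorem isExtreme_face {A : Set E} (g : E →L[ℝ] ℝ) (v : E) (h : ∀ x ∈ A, g (x - v) ≤ 0) :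
    IsExtreme ℝ A {x ∈ A | g (x - v) = 0} := by
  refine ⟨fun x hx => hx.1, fun x hx y hy z hz hzxy => ⟨hx, ?_⟩⟩
  obtain ⟨a, b, ha, hb, hab, rfl⟩ := hzxy
  have h1 : g (a • x + b • y - v) = a * g (x - v) + b * g (y - v) := by
    have : a • x + b • y - v = a • (x - v) + b • (y - v) := by
      rw [smul_sub, smul_sub]
      nth_rewrite 1 [← one_smul ℝ v]
      rw [← hab, add_smul]
      abel
    rw [this]
    simp
  have h2 := hz.2
  rw [h1] at h2
  have := h x hx
  have h3 := mul_nonpos_of_nonneg_of_nonpos hb.le (h y hy)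
  have h4 : 0 ≤ a * g (x - v) := by linarith
  exact le_antisymm this (nonneg_of_mul_nonneg_right h4 ha)

theorem face_convex {A : Set E} (hA : Convex ℝ A) (g : E →L[ℝ] ℝ) (v : E) :
    Convex ℝ {x ∈ A | g (x - v) = 0} := by
  have : {x ∈ A | g (x - v) = 0} = A ∩ {x | g.toLinearMap x = g v} := by
    ext x
    simp [sub_eq_zero]
  rw [this]
  exact hA.inter (convex_hyperplane g.toLinearMap.isLinear _)

theorem face_isCompact {A : Set E} (hA : IsCompact A) (g : E →L[ℝ] ℝ) (v : E) :
    IsCompact {x ∈ A | g (x - v) = 0} :=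
  hA.inter_right (isClosed_eq (by fun_prop : Continuous fun x => g (x - v)) continuous_const)

theorem le_of_forall_extremePoints {A : Set E} (hc : IsCompact A) (hconv : Convex ℝ A)
    (g : E →L[ℝ] ℝ) (v : E) (h : ∀ x ∈ A.extremePoints ℝ, g (x - v) ≤ 0) :
    ∀ x ∈ A, g (x - v) ≤ 0 := by
  have hset : {x | g (x - v) ≤ 0} = {x | g.toLinearMap x ≤ g v} := by
    ext x
    simp
  have hcl : IsClosed {x | g (x - v) ≤ 0} :=
    isClosed_le (by fun_prop : Continuous fun x => g (x - v)) continuous_const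
  have hcv : Convex ℝ {x | g (x - v) ≤ 0} := by
    rw [hset]
    exact convex_halfSpace_le g.toLinearMap.isLinear _
  have := closure_minimal (convexHull_min (show A.extremePoints ℝ ⊆ {x | g (x - v) ≤ 0} from h) hcv)
    hcl
  rwa [closure_convexHull_extremePoints hc hconv] at this

/-- Krein–Milman: `A` is the closed convex hull of its extreme points. -/
theorem eq_segment_of_extremePoints_subset {A : Set E} (hc : IsCompact A) (hconv : Convex ℝ A)
    {v w : E} (hv : v ∈ A) (hw : w ∈ A) (h : A.extremePoints ℝ ⊆ {v, w}) : A = segment ℝ v w := by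
  refine (?_ : A ⊆ _).antisymm (hconv.segment_subset hv hw)
  nth_rewrite 1 [← closure_convexHull_extremePoints hc hconv]
  refine closure_minimal (convexHull_min (h.trans ?_) (convex_segment v w)) ?_
  · rintro x (rfl | rfl)
    · exact left_mem_segment ℝ _ _
    · exact right_mem_segment ℝ _ _
  · rw [← convexHull_pair]
    exact (Set.toFinite {v, w}).isClosed_convexHull ℝ

/-- The face exposed by `g` is extreme, and its only extreme points are `v` and `w`. The conditions
on `g` need checking only at extreme points. -/
theorem isExtreme_segment {A : Set E} (hc : IsCompact A) (hconv : Convex ℝ A) {v w : E}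
    (hv : v ∈ A.extremePoints ℝ) (hw : w ∈ A.extremePoints ℝ) (g : E →L[ℝ] ℝ)
    (hle : ∀ x ∈ A.extremePoints ℝ, g (x - v) ≤ 0) (hw0 : g (w - v) = 0)
    (huniq : ∀ x ∈ A.extremePoints ℝ, g (x - v) = 0 → x = v ∨ x = w) :
    IsExtreme ℝ A (segment ℝ v w) := by
  have hext := isExtreme_face g v (le_of_forall_extremePoints hc hconv g v hle)
  rw [← eq_segment_of_extremePoints_subset (face_isCompact hc g v) (face_convex hconv g v)
    (v := v) (w := w) ⟨hv.1, by simp⟩ ⟨hw.1, hw0⟩]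
  · exact hext
  · rw [hext.extremePoints_eq]
    exact fun x hx => huniq x hx.2 hx.1.2

theorem finrank_vectorSpan_segment_le (v w : E) :
    Module.finrank ℝ (vectorSpan ℝ (segment ℝ v w)) ≤ 1 := by
  refine (Submodule.finrank_mono (t := Submodule.span ℝ {w - v}) ?_).trans
    ((finrank_span_le_card {w - v}).trans (by simp))
  rw [vectorSpan_def, Submodule.span_le]
  rintro _ ⟨x, hx, y, hy, rfl⟩
  rw [segment_eq_image'] at hx hy
  obtain ⟨a, -, rfl⟩ := hx
  obtain ⟨b, -, rfl⟩ := hy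
  exact Submodule.mem_span_singleton.2 ⟨a - b, by simp [sub_smul]⟩

/-- A vertex of a convex polygon lies on exactly two edges. -/
theorem exists_two_edges {F : Set E} (hc : IsCompact F) (hconv : Convex ℝ F)
    (hfin : (F.extremePoints ℝ).Finite) (hdim : Module.finrank ℝ (vectorSpan ℝ F) = 2) {v : E}
    (hv : v ∈ F.extremePoints ℝ) :
    ∃ w₁ w₂, w₁ ≠ w₂ ∧ ∀ w, (w ∈ F.extremePoints ℝ ∧ w ≠ v ∧ IsExtreme ℝ F (segment ℝ v w)) ↔
      w = w₁ ∨ w = w₂ := by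
  classical
  set X : Set E := F.extremePoints ℝ \ {v} with hX
  have hXfin : X.Finite := hfin.subset Set.sdiff_subset
  have hvX : v ∉ convexHull ℝ X := by
    have := (hconv.mem_extremePoints_iff_mem_sdiff_convexHull_sdiff.1 hv).2
    exact fun h => this (convexHull_mono (Set.sdiff_subset_sdiff_left extremePoints_subset) h)
  -- An extreme point is separated strictly from the hull of the other vertices, so `l (x - v)` is a
  -- positive height on `X`.
  obtain ⟨l, s, hl1, hl2⟩ := geometric_hahn_banach_point_closed (convex_convexHull ℝ X)
    (hXfin.isClosed_convexHull ℝ) hvX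
  have hl : ∀ x ∈ X, 0 < l (x - v) := fun x hx => by
    have := hl2 x (subset_convexHull ℝ X hx)
    rw [map_sub]
    linarith
  have hspan : ∀ x ∈ F, x - v ∈ vectorSpan ℝ F := fun x hx =>
    vsub_mem_vectorSpan ℝ hx hv.1
  have hXF : ∀ x ∈ X, x ∈ F := fun x hx => hx.1.1
  have hXv : ∀ x ∈ X, x ≠ v := fun x hx => hx.2
  have hnot : ∀ w ∈ F, ∃ x ∈ X, x ≠ w := by
    intro w hw
    by_contra! hcon
    have := eq_segment_of_extremePoints_subset hc hconv hv.1 hw (fun x hx => by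
      by_cases hxv : x = v
      · exact Or.inl hxv
      · exact Or.inr (hcon x ⟨hx, hxv⟩))
    have h2 := finrank_vectorSpan_segment_le v w
    rw [← this] at h2
    omega
  obtain ⟨x₀, hx₀, -⟩ := hnot v hv.1
  -- The kernel of `l` in the two-dimensional direction space is at most a line. With `p` spanning
  -- it, `l` and the inner product with `p` separate the directions of `F`.
  obtain ⟨p, hp⟩ : ∃ p : E, ∀ x ∈ vectorSpan ℝ F, l x = 0 → inner ℝ p x = 0 → x = 0 := by
    have : FiniteDimensional ℝ (vectorSpan ℝ F) := Module.finite_of_finrank_pos (by omega)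
    have hlt : vectorSpan ℝ F ⊓ LinearMap.ker l.toLinearMap < vectorSpan ℝ F := by
      refine lt_of_le_of_ne inf_le_left fun h => ?_
      have h3 := hspan x₀ (hXF _ hx₀)
      rw [← h] at h3
      have h4 : l (x₀ - v) = 0 := h3.2
      exact (hl x₀ hx₀).ne' h4
    have h1 := Submodule.finrank_lt_finrank_of_lt hlt
    have h2 : Module.finrank ℝ ↥(vectorSpan ℝ F ⊓ LinearMap.ker l.toLinearMap) ≤ 1 := by omega
    have := Submodule.finiteDimensional_of_le hlt.le
    obtain ⟨p, hp⟩ := finrank_le_one_iff.1 h2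
    refine ⟨p, fun x hx hlx hpx => ?_⟩
    obtain ⟨c, hcx⟩ := hp ⟨x, hx, hlx⟩
    have hcx' : c • (p : E) = x := congrArg Subtype.val hcx
    rw [← inner_self_eq_zero (𝕜 := ℝ)]
    nth_rewrite 1 [← hcx']
    rw [real_inner_smul_left, hpx, mul_zero]
  -- `τ x` is the slope of the ray from `v` to `x`. Distinct vertices have distinct slopes, since
  -- the nearer of two on one ray would not be extreme.
  obtain ⟨τ, hτl⟩ : ∃ τ : E → ℝ, ∀ x ∈ X, inner ℝ p (x - v) = τ x * l (x - v) :=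
    ⟨fun x => inner ℝ p (x - v) / l (x - v), fun x hx => (div_mul_cancel₀ _ (hl x hx).ne').symm⟩
  have hray : ∀ x ∈ X, ∀ y ∈ X, ∀ a : ℝ, 0 < a → a < 1 → x - v ≠ a • (y - v) := by
    intro x hx y hy a ha0 ha1 h
    refine hXv x hx (hx.1.2 hv.1 (hXF y hy) ⟨1 - a, a, by linarith, ha0, by ring, ?_⟩).symm
    rw [← sub_add_cancel x v, h]
    module
  have hinj : ∀ x ∈ X, ∀ y ∈ X, τ x = τ y → x = y := by
    intro x hx y hy hxy
    have hlx := hl x hx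
    have hly := hl y hy
    have h0 := hp (l (y - v) • (x - v) - l (x - v) • (y - v))
      (sub_mem (Submodule.smul_mem _ _ (hspan x (hXF x hx)))
        (Submodule.smul_mem _ _ (hspan y (hXF y hy))))
      (by rw [map_sub, map_smul, map_smul, smul_eq_mul, smul_eq_mul]; ring)
      (by rw [inner_sub_right, real_inner_smul_right, real_inner_smul_right, hτl x hx, hτl y hy,
            hxy]; ring)
    rw [sub_eq_zero] at h0
    rcases lt_trichotomy (l (x - v)) (l (y - v)) with hlt | heq | hlt
    · refine absurd ?_ (hray x hx y hy (l (x - v) / l (y - v)) (by positivity)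
        ((div_lt_one hly).2 hlt))
      rw [div_eq_inv_mul, mul_smul, ← h0, smul_smul, inv_mul_cancel₀ hly.ne', one_smul]
    · rw [heq] at h0
      exact sub_left_injective (smul_right_injective E hly.ne' h0)
    · refine absurd ?_ (hray y hy x hx (l (y - v) / l (x - v)) (by positivity)
        ((div_lt_one hlx).2 hlt))
      rw [div_eq_inv_mul, mul_smul, h0, smul_smul, inv_mul_cancel₀ hlx.ne', one_smul]
  -- A vertex of extremal slope gives an edge: the functional below has the sign of the slope
  -- difference. The sign of `σ` selects maximum or minimum.
  have hedge : ∀ σ : ℝ, σ ≠ 0 → ∀ w ∈ X, (∀ x ∈ X, σ * τ x ≤ σ * τ w) →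
      IsExtreme ℝ F (segment ℝ v w) := by
    intro σ hσ w hw hmax
    have hval : ∀ x ∈ X, (σ • innerSL ℝ p - (σ * τ w) • l) (x - v) =
        (σ * τ x - σ * τ w) * l (x - v) := fun x hx => by
      simp only [sub_apply, smul_apply,
        innerSL_apply_apply, hτl x hx, smul_eq_mul]
      ring
    refine isExtreme_segment hc hconv hv hw.1 (σ • innerSL ℝ p - (σ * τ w) • l) ?_ ?_ ?_
    · intro x hx
      by_cases hxv : x = v
      · simp [hxv]
      · rw [hval x ⟨hx, hxv⟩]
        exact mul_nonpos_of_nonpos_of_nonneg (by linarith [hmax x ⟨hx, hxv⟩]) (hl x ⟨hx, hxv⟩).le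
    · rw [hval w hw]
      ring
    · intro x hx hx0
      by_cases hxv : x = v
      · exact Or.inl hxv
      · rw [hval x ⟨hx, hxv⟩] at hx0
        rcases mul_eq_zero.1 hx0 with h | h
        · exact Or.inr (hinj x ⟨hx, hxv⟩ w hw (mul_left_cancel₀ hσ (by linarith)))
        · exact absurd h (hl x ⟨hx, hxv⟩).ne'
  obtain ⟨a, ha, hamin⟩ := Set.exists_min_image X τ hXfin ⟨x₀, hx₀⟩
  obtain ⟨b, hb, hbmax⟩ := Set.exists_max_image X τ hXfin ⟨x₀, hx₀⟩
  have hab : a ≠ b := by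
    rintro rfl
    obtain ⟨x, hx, hxa⟩ := hnot a (hXF a ha)
    exact hxa (hinj x hx a ha (le_antisymm (hbmax x hx) (hamin x hx)))
  refine ⟨a, b, hab, fun w => ⟨?_, ?_⟩⟩
  · rintro ⟨hw, hwv, hext⟩
    have hwX : w ∈ X := ⟨hw, hwv⟩
    by_contra! hcon
    have h1 : τ a < τ w := lt_of_le_of_ne (hamin w hwX) fun h => hcon.1 (hinj w hwX a ha h.symm)
    have h2 : τ w < τ b := lt_of_le_of_ne (hbmax w hwX) fun h => hcon.2 (hinj w hwX b hb h)
    -- Cut the three rays at a common height `ε`. The point on the ray to `w` is then strictly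
    -- between the other two, so extremality of the segment `vw` would put the point of the ray to
    -- `a` on it, forcing equal slopes.
    obtain ⟨ε, hε, hεa, hεb, hεw⟩ :
        ∃ ε : ℝ, 0 < ε ∧ ε ≤ l (a - v) ∧ ε ≤ l (b - v) ∧ ε ≤ l (w - v) :=
      ⟨min (l (a - v)) (min (l (b - v)) (l (w - v))),
        lt_min (hl a ha) (lt_min (hl b hb) (hl w hwX)), min_le_left _ _,
        (min_le_right _ _).trans (min_le_left _ _), (min_le_right _ _).trans (min_le_right _ _)⟩
    have hmem : ∀ x ∈ X, ε ≤ l (x - v) → v + (ε / l (x - v)) • (x - v) ∈ segment ℝ v x := by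
      intro x hx hεx
      rw [segment_eq_image']
      exact ⟨_, ⟨(div_pos hε (hl x hx)).le, (div_le_one (hl x hx)).2 hεx⟩, rfl⟩
    have hsub : ∀ x ∈ X, segment ℝ v x ⊆ F := fun x hx => hconv.segment_subset hv.1 (hXF x hx)
    have hla := hl a ha
    have hlb := hl b hb
    have hlw := hl w hwX
    have hba : 0 < τ b - τ a := by linarith
    obtain ⟨t, ht0, ht1, htw⟩ : ∃ t : ℝ, 0 < t ∧ t < 1 ∧ t * (τ b - τ a) = τ w - τ a :=
      ⟨(τ w - τ a) / (τ b - τ a), div_pos (by linarith) hba, (div_lt_one hba).2 (by linarith),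
        div_mul_cancel₀ _ hba.ne'⟩
    have hcancel : ∀ c d : ℝ, 0 < d → ε / d * (c * d) = c * ε := fun c d hd => by field_simp
    have hcomb : (ε / l (w - v)) • (w - v) - ((1 - t) • (ε / l (a - v)) • (a - v) +
        t • (ε / l (b - v)) • (b - v)) = 0 := by
      apply hp
      · exact sub_mem (Submodule.smul_mem _ _ (hspan w (hXF w hwX)))
          (add_mem (Submodule.smul_mem _ _ (Submodule.smul_mem _ _ (hspan a (hXF a ha))))
            (Submodule.smul_mem _ _ (Submodule.smul_mem _ _ (hspan b (hXF b hb)))))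
      · simp only [map_sub l _ (_ + _), map_add, map_smul, smul_eq_mul, div_mul_cancel₀ _ hla.ne',
          div_mul_cancel₀ _ hlb.ne', div_mul_cancel₀ _ hlw.ne']
        ring
      · simp only [inner_sub_right _ _ (_ + _), inner_add_right, real_inner_smul_right, hτl a ha,
          hτl b hb, hτl w hwX, hcancel _ _ hla, hcancel _ _ hlb, hcancel _ _ hlw]
        linear_combination (-ε) * htw
    have hseg : v + (ε / l (a - v)) • (a - v) ∈ segment ℝ v w := by
      refine hext.left_mem_of_mem_openSegment (hsub a ha (hmem a ha hεa))
        (hsub b hb (hmem b hb hεb)) (hmem w hwX hεw) ⟨1 - t, t, by linarith, ht0, by ring, ?_⟩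
      rw [sub_eq_zero] at hcomb
      rw [hcomb]
      module
    rw [segment_eq_image'] at hseg
    obtain ⟨c, -, hc'⟩ := hseg
    have hc2 : c • (w - v) = (ε / l (a - v)) • (a - v) := add_left_cancel hc'
    have e1 := congrArg l hc2
    have e2 := congrArg (fun x => inner ℝ p x) hc2
    simp only [map_smul, smul_eq_mul, div_mul_cancel₀ _ hla.ne'] at e1
    simp only [real_inner_smul_right, hτl a ha, hτl w hwX] at e2
    have e3 : τ w * ε = τ a * ε := by
      rw [← e1]
      rw [hcancel _ _ hla, ← e1] at e2
      linarith
    exact h1.ne' (mul_right_cancel₀ hε.ne' e3)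
  · rintro (rfl | rfl)
    · exact ⟨ha.1, hXv _ ha, hedge (-1) (by norm_num) _ ha fun x hx => by linarith [hamin x hx]⟩
    · exact ⟨hb.1, hXv _ hb, hedge 1 (by norm_num) _ hb fun x hx => by linarith [hbmax x hx]⟩

end Faces

/-! ### Facet normals at a vertex -/

/-- The unit vector `u` is an outward normal at `v` of a two-dimensional face of `K`. -/
structure IsFacetNormal (K : Set E3) (v u : E3) : Prop where
  norm_eq : ‖u‖ = 1
  le : ∀ x ∈ K, inner ℝ u (x - v) ≤ 0
  finrank_eq : Module.finrank ℝ (vectorSpan ℝ {x ∈ K | inner ℝ u (x - v) = 0}) = 2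

namespace IsFacetNormal

variable {K : Set E3} {v u u₁ u₂ u₃ d : E3}

/-- Extremality is transitive, so the edges at `v` of the planar face are precisely the edges of `K`
at `v` inside it, and the polygon case applies. -/
theorem exists_two_edges (hu : IsFacetNormal K v u) (hc : IsCompact K) (hconv : Convex ℝ K)
    (hfin : (K.extremePoints ℝ).Finite) (hv : v ∈ K.extremePoints ℝ) :
    ∃ w₁ w₂, w₁ ≠ w₂ ∧ ∀ w, (w ∈ K.extremePoints ℝ ∧ w ≠ v ∧ IsExtreme ℝ K (segment ℝ v w) ∧
      inner ℝ u (w - v) = 0) ↔ w = w₁ ∨ w = w₂ := by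
  have hext : IsExtreme ℝ K {x ∈ K | inner ℝ u (x - v) = 0} := isExtreme_face (innerSL ℝ u) v hu.le
  have hFc : IsCompact {x ∈ K | inner ℝ u (x - v) = 0} := face_isCompact hc (innerSL ℝ u) v
  have hFconv : Convex ℝ {x ∈ K | inner ℝ u (x - v) = 0} := face_convex hconv (innerSL ℝ u) v
  have hvF : v ∈ {x ∈ K | inner ℝ u (x - v) = 0} := ⟨hv.1, by simp⟩
  have heq := hext.extremePoints_eq
  obtain ⟨w₁, w₂, hne, hw⟩ := StokerYokota.exists_two_edges hFc hFconv
    (hfin.subset (by rw [heq]; exact Set.inter_subset_right)) hu.finrank_eq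
    (v := v) (by rw [heq]; exact ⟨hvF, hv⟩)
  refine ⟨w₁, w₂, hne, fun w => ?_⟩
  rw [← hw, heq]
  constructor
  · rintro ⟨h1, h2, h3, h4⟩
    exact ⟨⟨⟨h1.1, h4⟩, h1⟩, h2, h3.mono hext.subset (hFconv.segment_subset hvF ⟨h1.1, h4⟩)⟩
  · rintro ⟨⟨h1, h1'⟩, h2, h3⟩
    exact ⟨h1', h2, hext.trans h3, h1.2⟩

theorem exists_notMem_span (hu : IsFacetNormal K v u) (d : E3) :
    ∃ p ∈ K, inner ℝ u (p - v) = 0 ∧ p - v ∉ Submodule.span ℝ {d} := by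
  by_contra! hcon
  have h1 : vectorSpan ℝ {x ∈ K | inner ℝ u (x - v) = 0} ≤ Submodule.span ℝ {d} := by
    rw [vectorSpan_def, Submodule.span_le]
    rintro _ ⟨x, hx, y, hy, rfl⟩
    change x - y ∈ Submodule.span ℝ {d}
    rw [← sub_sub_sub_cancel_right x y v]
    exact sub_mem (hcon x hx.1 hx.2) (hcon y hy.1 hy.2)
  have h2 := (Submodule.finrank_mono h1).trans (finrank_span_le_card {d})
  rw [hu.finrank_eq] at h2
  simp at h2

/-- An edge with direction `d` lies on at most two facets. -/
theorem eq_or_eq (hint : (interior K).Nonempty) (h₁ : IsFacetNormal K v u₁)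
    (h₂ : IsFacetNormal K v u₂) (h₃ : IsFacetNormal K v u₃) (hne : u₁ ≠ u₂) (hd : d ≠ 0)
    (hd₁ : inner ℝ u₁ d = 0) (hd₂ : inner ℝ u₂ d = 0) (hd₃ : inner ℝ u₃ d = 0) :
    u₃ = u₁ ∨ u₃ = u₂ := by
  -- Opposite normals would confine `K` to a plane, contradicting its interior.
  have hopp : u₁ ≠ -u₂ := by
    intro h
    have hzero : ∀ x ∈ K, inner ℝ u₁ (x - v) = 0 := fun x hx =>
      le_antisymm (h₁.le x hx) (by have := h₂.le x hx; rw [h, inner_neg_left]; linarith)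
    obtain ⟨x, hx⟩ := hint
    have hcont : Tendsto (fun t : ℝ => x + t • u₁) (𝓝[>] 0) (𝓝 x) := by
      have : Continuous fun t : ℝ => x + t • u₁ := by fun_prop
      simpa using (this.tendsto 0).mono_left nhdsWithin_le_nhds
    obtain ⟨t, ht, ht0⟩ := ((hcont.eventually (isOpen_interior.mem_nhds hx)).and
      self_mem_nhdsWithin).exists
    have e1 := hzero _ (interior_subset ht)
    have e2 := hzero _ (interior_subset hx)
    rw [add_sub_right_comm, inner_add_right, e2, real_inner_smul_right, real_inner_self_eq_norm_sq,
      h₁.norm_eq] at e1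
    have : (0 : ℝ) < t := ht0
    linarith
  have hind : LinearIndependent ℝ ![u₁, u₂] := by
    rw [LinearIndependent.pair_iff' (by intro h; simpa [h] using h₁.norm_eq)]
    intro a ha
    have hn : |a| = 1 := by
      have := congrArg norm ha
      rwa [norm_smul, h₁.norm_eq, h₂.norm_eq, mul_one] at this
    rcases abs_eq (zero_le_one) |>.1 hn with rfl | rfl
    · exact hne (by simpa using ha)
    · exact hopp (by rw [← ha]; simp)
  have hspan : Submodule.span ℝ {u₁, u₂} = (Submodule.span ℝ {d})ᗮ := by
    have : Fact (Module.finrank ℝ E3 = 2 + 1) := ⟨by simp⟩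
    refine Submodule.eq_of_le_of_finrank_eq ?_ ?_
    · rw [Submodule.span_le]
      rintro x (rfl | rfl) <;>
        exact Submodule.mem_orthogonal_singleton_iff_inner_left.2 (by assumption)
    · rw [Submodule.finrank_orthogonal_span_singleton (n := 2) hd]
      have := finrank_span_eq_card hind
      rw [Matrix.range_cons_cons_empty] at this
      simpa using this
  have hpar : ∀ x, inner ℝ u₁ x = 0 → inner ℝ u₂ x = 0 → x ∈ Submodule.span ℝ {d} := by
    intro x hx₁ hx₂
    rw [← Submodule.orthogonal_orthogonal (Submodule.span ℝ {d}), ← hspan,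
      Submodule.mem_orthogonal]
    intro y hy
    obtain ⟨a, b, rfl⟩ := Submodule.mem_span_pair.1 hy
    rw [inner_add_left, real_inner_smul_left, real_inner_smul_left, hx₁, hx₂]
    simp
  -- All three normals lie in the plane orthogonal to `d`, which `u₁` and `u₂` span. Testing at a
  -- point of each of the first two facets off the edge line shows that both coefficients are
  -- nonnegative.
  obtain ⟨a, b, rfl⟩ : ∃ a b : ℝ, a • u₁ + b • u₂ = u₃ := by
    rw [← Submodule.mem_span_pair, hspan]
    exact Submodule.mem_orthogonal_singleton_iff_inner_left.2 hd₃
  have hexp : ∀ x, inner ℝ (a • u₁ + b • u₂) x = a * inner ℝ u₁ x + b * inner ℝ u₂ x := fun x => by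
    rw [inner_add_left, real_inner_smul_left, real_inner_smul_left]
  obtain ⟨p₁, hp₁, hp₁0, hp₁d⟩ := h₁.exists_notMem_span d
  obtain ⟨p₂, hp₂, hp₂0, hp₂d⟩ := h₂.exists_notMem_span d
  obtain ⟨p₃, hp₃, hp₃0, hp₃d⟩ := h₃.exists_notMem_span d
  have hb : 0 ≤ b := by
    have e := h₃.le p₁ hp₁
    rw [hexp, hp₁0, mul_zero, zero_add] at e
    have := lt_of_le_of_ne (h₂.le p₁ hp₁) fun h => hp₁d (hpar _ hp₁0 h)
    by_contra! hb
    nlinarith [mul_pos_of_neg_of_neg hb this]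
  have ha : 0 ≤ a := by
    have e := h₃.le p₂ hp₂
    rw [hexp, hp₂0, mul_zero, add_zero] at e
    have := lt_of_le_of_ne (h₁.le p₂ hp₂) fun h => hp₂d (hpar _ h hp₂0)
    by_contra! ha
    nlinarith [mul_pos_of_neg_of_neg ha this]
  rw [hexp] at hp₃0
  have f₁ := mul_nonpos_of_nonneg_of_nonpos ha (h₁.le p₃ hp₃)
  have f₂ := mul_nonpos_of_nonneg_of_nonpos hb (h₂.le p₃ hp₃)
  -- Two nonpositive terms sum to zero at a point of the third facet off the edge line, so one
  -- coefficient must vanish; unit length fixes the other.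
  have g₁ : a * inner ℝ u₁ (p₃ - v) = 0 := by linarith
  have g₂ : b * inner ℝ u₂ (p₃ - v) = 0 := by linarith
  have hnorm := h₃.norm_eq
  rcases mul_eq_zero.1 g₁ with rfl | k₁
  · right
    rw [zero_smul, zero_add, norm_smul, h₂.norm_eq, mul_one, Real.norm_eq_abs,
      abs_of_nonneg hb] at hnorm
    simp [hnorm]
  · rcases mul_eq_zero.1 g₂ with rfl | k₂
    · left
      rw [zero_smul, add_zero, norm_smul, h₁.norm_eq, mul_one, Real.norm_eq_abs,
        abs_of_nonneg ha] at hnorm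
      simp [hnorm]
    · exact absurd (hpar _ k₁ k₂) hp₃d

end IsFacetNormal

/-! ### From Minkowski products to Euclidean angles -/

/-- A linear map that carries the Minkowski form on the normals of the planes through `v` to the
Euclidean inner product. -/
def straighten (v n : E3) : E3 := n - (inner ℝ n v / (1 + √(1 - ‖v‖ ^ 2))) • v

theorem straighten_smul (v : E3) (c : ℝ) (n : E3) : straighten v (c • n) = c • straighten v n := by
  simp only [straighten, real_inner_smul_left, smul_sub, smul_smul, mul_div_assoc]

/-- The coefficient `t = 1 / (1 + √(1 - ‖v‖ ^ 2))` in `straighten` solves `2 * t - t ^ 2 * ‖v‖ ^ 2 =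
1`. -/
theorem inner_straighten {v : E3} (hv : v ∈ ball3) (n m : E3) :
    inner ℝ (straighten v n) (straighten v m) = inner ℝ n m - inner ℝ n v * inner ℝ m v := by
  have hv1 : ‖v‖ < 1 := by simpa [ball3] using hv
  have hs := Real.sq_sqrt (show 0 ≤ 1 - ‖v‖ ^ 2 by nlinarith [norm_nonneg v])
  have hs0 := Real.sqrt_nonneg (1 - ‖v‖ ^ 2)
  simp only [straighten, inner_sub_left, inner_sub_right, real_inner_smul_left,
    real_inner_smul_right, real_inner_self_eq_norm_sq, real_inner_comm m v]
  generalize √(1 - ‖v‖ ^ 2) = s at hs hs0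
  have hvs : ‖v‖ ^ 2 = 1 - s ^ 2 := by linarith
  rw [hvs]
  have : 1 + s ≠ 0 := by positivity
  field_simp
  ring

theorem straighten_ne_zero {v : E3} (hv : v ∈ ball3) {n : E3} (hn : ‖n‖ = 1) :
    straighten v n ≠ 0 := by
  intro h
  have h1 := inner_straighten hv n n
  have hv1 : ‖v‖ < 1 := by simpa [ball3] using hv
  rw [h, inner_zero_left, real_inner_self_eq_norm_sq, hn] at h1
  have h2 := abs_real_inner_le_norm n v
  rw [hn, one_mul] at h2
  have h3 : |inner ℝ n v| * |inner ℝ n v| = 1 := by rw [abs_mul_abs_self]; linarith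
  nlinarith [abs_nonneg (inner ℝ n v)]

/-- For a wall through `v` the offset is the inner product of the normal with `v`, so
`inner_straighten` computes the Minkowski product. Exterior angles thus become distances on a
sphere, with a triangle inequality. -/
theorem HalfSpace.exteriorAngle_eq_angle {v : E3} {h k : HalfSpace} (hh : v ∈ h.wall)
    (hk : v ∈ k.wall) : h.exteriorAngle k =
      InnerProductGeometry.angle (straighten v h.normal) (straighten v k.normal) := by
  have key : ∀ h k : HalfSpace, v ∈ h.wall → v ∈ k.wall → h.lorentz k =
      inner ℝ (straighten v h.normal) (straighten v k.normal) := fun h k hh hk => by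
    rw [inner_straighten hh.1, HalfSpace.lorentz, hh.2, hk.2]
  rw [exteriorAngle, InnerProductGeometry.angle, key h k hh hk, key h h hh hh, key k k hk hk,
    real_inner_self_eq_norm_sq, real_inner_self_eq_norm_sq, Real.sqrt_sq (norm_nonneg _),
    Real.sqrt_sq (norm_nonneg _)]

/-! ### Polygon inequality for exterior dihedral angles -/

namespace HypPolyhedron

variable (P : HypPolyhedron)

theorem carrier_convex : Convex ℝ P.carrier := by
  obtain ⟨S, hS⟩ := P.exists_halfSpaces
  have : P.carrier = ball3 ∩ ⋂ h ∈ S, {x : E3 | inner ℝ h.normal x ≤ h.offset} := by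
    rw [hS]
    ext x
    simp only [HalfSpace.carrier, Set.mem_ofPred_eq, Set.mem_inter_iff, Set.mem_iInter]
    exact ⟨fun hx => ⟨hx.1, fun h hh => (hx.2 h hh).2⟩,
      fun hx => ⟨hx.1, fun h hh => ⟨hx.1, hx.2 h hh⟩⟩⟩
  rw [this]
  exact (convex_ball _ _).inter (convex_iInter₂ fun h _ =>
    convex_halfSpace_le (innerSL ℝ h.normal).toLinearMap.isLinear _)

/-- Unit normals turn facets through `v` into points whose incidences can be counted; positive
rescaling changes neither the facet nor the angle. -/
theorem HasDihedralAngle.exists_facetNormals {P : HypPolyhedron} {v w : E3} {θ : ℝ}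
    (h : P.HasDihedralAngle v w θ) :
    ∃ u₁ u₂ : {u : E3 // ‖u‖ = 1}, u₁ ≠ u₂ ∧ IsFacetNormal P.carrier v u₁ ∧
      IsFacetNormal P.carrier v u₂ ∧ inner ℝ u₁.1 (w - v) = 0 ∧ inner ℝ u₂.1 (w - v) = 0 ∧
      Real.pi - θ = InnerProductGeometry.angle (straighten v u₁) (straighten v u₂) := by
  obtain ⟨h, k, hh, hk, hne, hvh, hwh, hvk, hwk, rfl⟩ := h
  have hpos : ∀ h : HalfSpace, 0 < ‖h.normal‖ := fun h => (abs_nonneg _).trans_lt h.meets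
  have hnorm : ∀ h : HalfSpace, ‖‖h.normal‖⁻¹ • h.normal‖ = 1 := fun h => by
    rw [norm_smul, norm_inv, norm_norm, inv_mul_cancel₀ (hpos h).ne']
  have hzero : ∀ h : HalfSpace, v ∈ h.wall → ∀ x, inner ℝ (‖h.normal‖⁻¹ • h.normal) (x - v) =
      ‖h.normal‖⁻¹ * (inner ℝ h.normal x - h.offset) := fun h hv x => by
    rw [real_inner_smul_left, inner_sub_right, hv.2]
  have hset : ∀ h : HalfSpace, P.SupportsFacet h → v ∈ h.wall → P.carrier ∩ h.wall =
      {x ∈ P.carrier | inner ℝ (‖h.normal‖⁻¹ • h.normal) (x - v) = 0} := fun h hs hv => by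
    ext x
    rw [Set.mem_inter_iff, Set.mem_ofPred_eq, hzero h hv, mul_eq_zero, sub_eq_zero]
    refine and_congr_right fun hx => ⟨fun hw => Or.inr hw.2, fun hx0 => ⟨(hs.1 hx).1, ?_⟩⟩
    exact hx0.resolve_left (inv_ne_zero (hpos h).ne')
  have hfacet : ∀ h : HalfSpace, P.SupportsFacet h → v ∈ h.wall →
      IsFacetNormal P.carrier v (‖h.normal‖⁻¹ • h.normal) := fun h hs hv => by
    refine ⟨hnorm h, fun x hx => ?_, ?_⟩
    · rw [hzero h hv]
      exact mul_nonpos_of_nonneg_of_nonpos (inv_nonneg.2 (norm_nonneg _))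
        (sub_nonpos.2 (hs.1 hx).2)
    · rw [← hset h hs hv]
      exact hs.2
  refine ⟨⟨_, hnorm h⟩, ⟨_, hnorm k⟩, fun heq => hne ?_, hfacet h hh hvh, hfacet k hk hvk, ?_, ?_,
    ?_⟩
  · have heq' : ‖h.normal‖⁻¹ • h.normal = ‖k.normal‖⁻¹ • k.normal := congrArg Subtype.val heq
    rw [hset h hh hvh, hset k hk hvk, heq']
  · rw [hzero h hvh, hwh.2, sub_self, mul_zero]
  · rw [hzero k hvk, hwk.2, sub_self, mul_zero]
  · rw [straighten_smul, straighten_smul,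
      InnerProductGeometry.angle_smul_left_of_pos _ _ (inv_pos.2 (hpos h)),
      InnerProductGeometry.angle_smul_right_of_pos _ _ (inv_pos.2 (hpos k)),
      HalfSpace.exteriorAngle_eq_angle hvh hvk]
    ring

theorem mem_ball_of_mem_carrier {x : E3} (hx : x ∈ P.carrier) : x ∈ ball3 := by
  obtain ⟨S, hS⟩ := P.exists_halfSpaces
  rw [hS] at hx
  exact hx.1

open scoped Classical in
/-- The exterior dihedral angles at a vertex satisfy the polygon inequality. -/
theorem HasAngles.pi_sub_le_sum {P : HypPolyhedron} {V : Type*} [Fintype V] {Γ : SimpleGraph V}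
    {φ : Γ ≃g P.skeleton} {θ : Γ.edgeSet → ℝ} (h : P.HasAngles φ θ) (v : V)
    (w₀ : {w // Γ.Adj v w}) :
    Real.pi - θ ⟨s(v, w₀.1), w₀.2⟩ ≤
      ∑ w ∈ Finset.univ.erase w₀, (Real.pi - θ ⟨s(v, w.1), w.2⟩) := by
  have hfin : (P.carrier.extremePoints ℝ).Finite := Set.finite_coe_iff.1 (Finite.of_equiv V φ.toEquiv)
  choose u₁ u₂ hne hu₁ hu₂ hw₁ hw₂ hangle using
    fun w : {w // Γ.Adj v w} => (h v w.1 w.2).exists_facetNormals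
  have hvb : (φ v).1 ∈ ball3 := P.mem_ball_of_mem_carrier (φ v).2.1
  -- By `eq_or_eq`, `f` is one of the two chosen normals of an edge exactly when its facet contains
  -- that edge.
  have hterm : ∀ (f : {u : E3 // ‖u‖ = 1}) (w : {w // Γ.Adj v w}),
      ((if f = u₁ w then 1 else 0) + (if f = u₂ w then 1 else 0) : ℕ) =
      if IsFacetNormal P.carrier (φ v).1 f ∧ inner ℝ f.1 ((φ w.1).1 - (φ v).1) = 0
        then 1 else 0 := by
    intro f w
    by_cases hf : IsFacetNormal P.carrier (φ v).1 f ∧ inner ℝ f.1 ((φ w.1).1 - (φ v).1) = 0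
    · rw [if_pos hf]
      have hd : (φ w.1).1 - (φ v).1 ≠ 0 := fun h0 =>
        w.2.ne (φ.injective (Subtype.ext (sub_eq_zero.1 h0))).symm
      rcases (hu₁ w).eq_or_eq P.interior_nonempty (hu₂ w) hf.1
        (fun h => hne w (Subtype.ext h)) hd (hw₁ w) (hw₂ w) hf.2 with h1 | h1
      · obtain rfl := Subtype.ext h1
        simp [hne w]
      · obtain rfl := Subtype.ext h1
        simp [(hne w).symm]
    · rw [if_neg hf, if_neg, if_neg]
      · rintro rfl
        exact hf ⟨hu₂ w, hw₂ w⟩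
      · rintro rfl
        exact hf ⟨hu₁ w, hw₁ w⟩
  -- A facet normal is counted twice, once for each of its two edges at the vertex; any other unit
  -- vector is never counted.
  have heven : ∀ f : {u : E3 // ‖u‖ = 1}, Even (∑ w : {w // Γ.Adj v w},
      ((if f = u₁ w then 1 else 0) + (if f = u₂ w then 1 else 0))) := by
    intro f
    simp only [hterm f]
    by_cases hf : IsFacetNormal P.carrier (φ v).1 f
    · obtain ⟨x₁, x₂, hx, hiff⟩ := hf.exists_two_edges P.isCompact P.carrier_convex hfin (φ v).2
      have hlift : ∀ x, x = x₁ ∨ x = x₂ → ∃ w : {w // Γ.Adj v w}, (φ w.1).1 = x := by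
        intro x hx
        obtain ⟨h1, h2, h3, -⟩ := (hiff x).2 hx
        refine ⟨⟨φ.symm ⟨x, h1⟩, ?_⟩, by simp⟩
        rw [← φ.map_adj_iff]
        simp only [RelIso.apply_symm_apply]
        exact ⟨fun he => h2 (congrArg Subtype.val he).symm, h3⟩
      obtain ⟨a, ha⟩ := hlift x₁ (Or.inl rfl)
      obtain ⟨b, hb⟩ := hlift x₂ (Or.inr rfl)
      have hab : a ≠ b := by
        rintro rfl
        exact hx (ha.symm.trans hb)
      have hfilter : Finset.univ.filter (fun w : {w // Γ.Adj v w} =>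
          IsFacetNormal P.carrier (φ v).1 f ∧ inner ℝ f.1 ((φ w.1).1 - (φ v).1) = 0) = {a, b} := by
        ext w
        have hadj := φ.map_adj_iff.2 w.2
        have hinj : ∀ w' : {w // Γ.Adj v w}, (φ w.1).1 = (φ w'.1).1 ↔ w = w' := fun w' =>
          ⟨fun he => Subtype.ext (φ.injective (Subtype.ext he)), fun he => by rw [he]⟩
        have := hiff (φ w.1).1
        rw [← ha, ← hb, hinj, hinj] at this
        rw [Finset.mem_filter, Finset.mem_insert, Finset.mem_singleton, ← this]
        exact ⟨fun hw => ⟨(φ w.1).2, fun he => hadj.1 (Subtype.ext he.symm), hadj.2, hw.2.2⟩,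
          fun hw => ⟨Finset.mem_univ _, hf, hw.2.2.2⟩⟩
      rw [Finset.sum_boole, hfilter, Finset.card_pair hab]
      exact even_two
    · simp [hf]
  have := dist_le_sum_of_even_incidence
    (fun a b : {u : E3 // ‖u‖ = 1} =>
      InnerProductGeometry.angle (straighten (φ v).1 a) (straighten (φ v).1 b))
    (fun a => InnerProductGeometry.angle_self (straighten_ne_zero hvb a.2))
    (fun a b => InnerProductGeometry.angle_comm _ _)
    (fun a b c => InnerProductGeometry.angle_le_angle_add_angle _ _ _)
    ((Finset.univ.erase w₀).val.map fun w => (u₁ w, u₂ w)) (u₁ w₀) (u₂ w₀) (fun f => by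
      have := heven f
      rw [← Finset.add_sum_erase _ _ (Finset.mem_univ w₀)] at this
      rw [Multiset.map_map]
      exact this)
  rw [Multiset.map_map] at this
  rw [hangle w₀]
  refine this.trans (le_of_eq ?_)
  exact Finset.sum_congr rfl fun w _ => (hangle w).symm

theorem HasAngles.pi_sub_mem {P : HypPolyhedron} {V : Type*} {Γ : SimpleGraph V}
    {φ : Γ ≃g P.skeleton} {θ : Γ.edgeSet → ℝ} (h : P.HasAngles φ θ) (e : Γ.edgeSet) :
    Real.pi - θ e ∈ Set.Icc 0 Real.pi := by
  obtain ⟨e, he⟩ := e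
  induction e using Sym2.ind with
  | _ v w =>
    obtain ⟨a, b, -, -, -, -, -, -, -, hθ⟩ := h v w he
    rw [hθ, sub_sub_cancel]
    exact ⟨Real.arccos_nonneg _, Real.arccos_le_pi _⟩

end HypPolyhedron

/-! ### Rounding angles to admissible colourings -/

/-- Even colours close to `r (π - θ e) / 2π`. -/
def roundedColoring {V : Type*} {Γ : SimpleGraph V} (θ : Γ.edgeSet → ℝ) (r : ℕ) (e : Γ.edgeSet) :
    ℕ :=
  -- For small `r` rounding up could break the admissibility bounds; the zero colouring is harmless
  -- there and does not affect the limit.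
  if 20 ≤ r then 2 * ⌈r * (Real.pi - θ e) / (4 * Real.pi)⌉₊ else 0

variable {V : Type*} {Γ : SimpleGraph V} {θ : Γ.edgeSet → ℝ}

theorem le_roundedColoring {r : ℕ} (hr : 20 ≤ r) (e : Γ.edgeSet) :
    r * (Real.pi - θ e) / (2 * Real.pi) ≤ roundedColoring θ r e := by
  rw [roundedColoring, if_pos hr]
  push_cast
  have := Nat.le_ceil (r * (Real.pi - θ e) / (4 * Real.pi))
  have h2 : r * (Real.pi - θ e) / (2 * Real.pi) = 2 * (r * (Real.pi - θ e) / (4 * Real.pi)) := by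
    field_simp
    ring
  linarith

theorem roundedColoring_lt {r : ℕ} (hr : 20 ≤ r) (e : Γ.edgeSet) (he : 0 ≤ Real.pi - θ e) :
    (roundedColoring θ r e : ℝ) < r * (Real.pi - θ e) / (2 * Real.pi) + 2 := by
  rw [roundedColoring, if_pos hr]
  push_cast
  have := Nat.ceil_lt_add_one (a := r * (Real.pi - θ e) / (4 * Real.pi)) (by positivity)
  have h2 : r * (Real.pi - θ e) / (2 * Real.pi) = 2 * (r * (Real.pi - θ e) / (4 * Real.pi)) := by
    field_simp
    ring
  linarith

theorem even_roundedColoring (r : ℕ) (e : Γ.edgeSet) : Even (roundedColoring θ r e) := by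
  rw [roundedColoring]
  split_ifs <;> simp

open scoped Classical in
-- Rounding up only enlarges the right side of the polygon inequality and enlarges the left side by
-- less than 2. As both sides are even, the inequality survives exactly.
theorem isColoringSequence_roundedColoring [Fintype V]
    (hmem : ∀ e, Real.pi - θ e ∈ Set.Icc 0 Real.pi)
    (hpoly : ∀ (v : V) (w₀ : {w // Γ.Adj v w}), Real.pi - θ ⟨s(v, w₀.1), w₀.2⟩ ≤
      ∑ w ∈ Finset.univ.erase w₀, (Real.pi - θ ⟨s(v, w.1), w.2⟩)) :
    IsColoringSequence Γ θ (roundedColoring θ) := by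
  have hpi := Real.pi_pos
  have hsize : ∀ r : ℕ, 2 < r → ∀ e, roundedColoring θ r e + 2 < r ∧
      3 * roundedColoring θ r e + 4 ≤ 2 * r := by
    intro r hr2 e
    by_cases hr : 20 ≤ r
    · have h1 := roundedColoring_lt hr e (hmem e).1
      have h2 : r * (Real.pi - θ e) / (2 * Real.pi) ≤ r / 2 := by
        rw [div_le_div_iff₀ (by positivity) two_pos]
        nlinarith [mul_le_mul_of_nonneg_left (hmem e).2 (Nat.cast_nonneg (α := ℝ) r)]
      -- Exterior angles are at most `π`, so colours stay below `r / 2 + 2`; for `20 ≤ r` this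
      -- leaves room for both bounds.
      have h3 : 2 * roundedColoring θ r e < r + 4 := by
        have : (2 * roundedColoring θ r e : ℝ) < r + 4 := by linarith
        exact_mod_cast this
      omega
    · rw [roundedColoring, if_neg hr]
      omega
  have hsum : ∀ (r : ℕ) (v : V) (w₀ : {w // Γ.Adj v w}),
      roundedColoring θ r ⟨s(v, w₀.1), w₀.2⟩ ≤
        ∑ w ∈ Finset.univ.erase w₀, roundedColoring θ r ⟨s(v, w.1), w.2⟩ := by
    intro r v w₀
    by_cases hr : 20 ≤ r
    · have h1 := roundedColoring_lt (θ := θ) hr ⟨s(v, w₀.1), w₀.2⟩ (hmem _).1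
      have h2 : r * (Real.pi - θ ⟨s(v, w₀.1), w₀.2⟩) / (2 * Real.pi) ≤
          ∑ w ∈ Finset.univ.erase w₀, (roundedColoring θ r ⟨s(v, w.1), w.2⟩ : ℝ) := by
        calc _ ≤ r * (∑ w ∈ Finset.univ.erase w₀, (Real.pi - θ ⟨s(v, w.1), w.2⟩)) /
              (2 * Real.pi) := by
              gcongr
              exact hpoly v w₀
          _ ≤ _ := by
              rw [Finset.mul_sum, Finset.sum_div]
              exact Finset.sum_le_sum fun w _ => le_roundedColoring hr _
      have h3 : roundedColoring θ r ⟨s(v, w₀.1), w₀.2⟩ <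
          ∑ w ∈ Finset.univ.erase w₀, roundedColoring θ r ⟨s(v, w.1), w.2⟩ + 2 := by
        have := h1.trans_le (add_le_add_left h2 2)
        exact_mod_cast this
      have h4 := even_roundedColoring (θ := θ) r ⟨s(v, w₀.1), w₀.2⟩
      have h5 : Even (∑ w ∈ Finset.univ.erase w₀, roundedColoring θ r ⟨s(v, w.1), w.2⟩) :=
        Finset.even_sum _ fun w _ => even_roundedColoring r _
      rw [Nat.even_iff] at h4 h5
      omega
    · simp [roundedColoring, hr]
  refine ⟨fun r _ hr2 => ⟨fun e => ⟨even_roundedColoring r e, (hsize r hr2 e).1⟩, fun v => ?_⟩,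
    fun e => ?_⟩
  · set edge : {w // Γ.Adj v w} → Γ.edgeSet := fun w => ⟨s(v, w.1), w.2⟩ with hedge
    have hinj : Function.Injective edge := fun a b hab => by
      have := congrArg Subtype.val hab
      simp only [hedge, Sym2.congr_right] at this
      exact Subtype.ext this
    have hedge_mem : ∀ e : Γ.edgeSet, v ∈ e.1 ↔ ∃ w, edge w = e := by
      rintro ⟨e, he⟩
      constructor
      · intro hv
        obtain ⟨w, rfl⟩ := Sym2.mem_iff_exists.1 hv
        exact ⟨⟨w, he⟩, rfl⟩
      · rintro ⟨w, hw⟩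
        rw [← hw]
        exact Sym2.mem_mk_left _ _
    rcases isEmpty_or_nonempty {w // Γ.Adj v w} with hemp | hnon
    · refine ⟨[], List.nodup_nil, fun e => ?_, rfl⟩
      rw [hedge_mem]
      simp
    · obtain ⟨w₀, -, hmax⟩ := Finset.exists_max_image Finset.univ
        (fun w => roundedColoring θ r (edge w)) Finset.univ_nonempty
      refine ⟨(w₀ :: (Finset.univ.erase w₀).toList).map edge, ?_, fun e => ?_, ?_⟩
      · refine List.Nodup.map hinj (List.nodup_cons.2 ⟨by simp, Finset.nodup_toList _⟩)
      · rw [hedge_mem, List.mem_map]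
        refine exists_congr fun w => and_iff_right ?_
        rw [List.mem_cons, Finset.mem_toList, Finset.mem_erase]
        by_cases hw : w = w₀ <;> simp [hw]
      · rw [List.map_cons, List.map_cons]
        refine fusesTo_zero_of_le_sum (even_roundedColoring _ _) (hsize r hr2 _).1
          (hsize r hr2 _).2 _ ?_ ?_
        · intro b hb
          simp only [List.mem_map] at hb
          obtain ⟨_, ⟨w, -, rfl⟩, rfl⟩ := hb
          exact ⟨even_roundedColoring _ _, hmax w (Finset.mem_univ _)⟩
        · rw [List.map_map]
          refine (hsum r v w₀).trans (le_of_eq ?_)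
          rw [← Finset.sum_map_toList]
          rfl
  · have hev : ∀ᶠ r : ℕ in oddAtTop, 20 ≤ r := (eventually_ge_atTop 20).filter_mono inf_le_left
    -- Squeeze: a rounding error below 2 in the colour becomes less than `4π / r` after scaling.
    have hlim : Tendsto (fun r : ℕ => Real.pi - θ e + 4 * Real.pi / (r : ℝ)) oddAtTop
        (𝓝 (Real.pi - θ e)) := by
      have := (tendsto_const_div_atTop_nhds_zero_nat (4 * Real.pi)).const_add (Real.pi - θ e)
      rw [add_zero] at this
      exact this.mono_left inf_le_left
    refine tendsto_of_tendsto_of_tendsto_of_le_of_le' tendsto_const_nhds hlim ?_ ?_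
    · filter_upwards [hev] with r hr
      have h1 := le_roundedColoring (θ := θ) hr e
      have hr0 : (0 : ℝ) < r := by
        have : 0 < r := by omega
        exact_mod_cast this
      calc Real.pi - θ e = 2 * Real.pi * (r * (Real.pi - θ e) / (2 * Real.pi) / r) := by
            field_simp
        _ ≤ _ := by gcongr
    · filter_upwards [hev] with r hr
      have h1 := (roundedColoring_lt hr e (hmem e).1).le
      have hr0 : (0 : ℝ) < r := by
        have : 0 < r := by omega
        exact_mod_cast this
      calc _ ≤ 2 * Real.pi * ((r * (Real.pi - θ e) / (2 * Real.pi) + 2) / r) := by gcongr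
        _ = _ := by
            field_simp
            ring

theorem oddAtTop_neBot : oddAtTop.NeBot := frequently_mem_iff_neBot.1 Nat.frequently_odd

theorem HypPolyhedron.HasAngles.isColoringSequence [Fintype V] {P : HypPolyhedron}
    {φ : Γ ≃g P.skeleton} (h : P.HasAngles φ θ) : IsColoringSequence Γ θ (roundedColoring θ) :=
  isColoringSequence_roundedColoring h.pi_sub_mem h.pi_sub_le_sum

end StokerYokota
end

theorem mainTheorem9 (hvol : StokerYokota.VolumeConjecture.{u}) :
    StokerYokota.WeakStokerConjecture.{u} ∧
    ∀ (V : Type u) [Fintype V] (Γ : SimpleGraph V) (P₁ P₂ : StokerYokota.HypPolyhedron)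
      (φ₁ : Γ ≃g P₁.skeleton) (φ₂ : Γ ≃g P₂.skeleton) (θ : Γ.edgeSet → ℝ),
      P₁.HasAngles φ₁ θ → P₂.HasAngles φ₂ θ →
      ∃ col : ℕ → Γ.edgeSet → ℕ, StokerYokota.IsColoringSequence Γ θ col ∧
        Filter.Tendsto (StokerYokota.yokotaGrowth Γ col) StokerYokota.oddAtTop (nhds P₁.vol) ∧
        Filter.Tendsto (StokerYokota.yokotaGrowth Γ col) StokerYokota.oddAtTop (nhds P₂.vol) := by
  have key : ∀ (V : Type u) [Fintype V] (Γ : SimpleGraph V) (P₁ P₂ : StokerYokota.HypPolyhedron)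
      (φ₁ : Γ ≃g P₁.skeleton) (φ₂ : Γ ≃g P₂.skeleton) (θ : Γ.edgeSet → ℝ),
      P₁.HasAngles φ₁ θ → P₂.HasAngles φ₂ θ →
      ∃ col : ℕ → Γ.edgeSet → ℕ, StokerYokota.IsColoringSequence Γ θ col ∧
        Filter.Tendsto (StokerYokota.yokotaGrowth Γ col) StokerYokota.oddAtTop (nhds P₁.vol) ∧
        Filter.Tendsto (StokerYokota.yokotaGrowth Γ col) StokerYokota.oddAtTop (nhds P₂.vol) := by
    intro V _ Γ P₁ P₂ φ₁ φ₂ θ h₁ h₂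
    -- `roundedColoring θ` does not involve the polyhedron, so this one sequence serves for `P₂`
    -- too.
    have hcol := h₁.isColoringSequence
    exact ⟨_, hcol, hvol V Γ P₁ φ₁ θ h₁ _ hcol, hvol V Γ P₂ φ₂ θ h₂ _ hcol⟩
  refine ⟨fun V _ Γ P₁ P₂ φ₁ φ₂ θ h₁ h₂ => ?_, key⟩
  obtain ⟨col, -, hlim₁, hlim₂⟩ := key V Γ P₁ P₂ φ₁ φ₂ θ h₁ h₂
  -- Uniqueness of limits needs a nontrivial filter, that is, arbitrarily large odd `r`.
  have := StokerYokota.oddAtTop_neBot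
  exact tendsto_nhds_unique hlim₁ hlim₂
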